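/- Every finite cactus graph is Helly-$B_1$-EPG. Here a cactus is a connected (simple) graph in which any two distinct cycles have at most one vertex in common. A graph $G$ is Helly-$B_1$-EPG if one can assign to each vertex $v$ of $G$ a nontrivial simple path $P_v$ on the rectangular grid $\mathbb{Z}\times\mathbb{Z}$ with at most one bend (change of direction), such that two distinct vertices $u,v$ are adjacent in $G$ if and only if $P_u$ and $P_v$ share at least one grid edge, and such that the edge sets of the paths $P_v$ have the Helly property: every nonempty subfamily of pairwise intersecting edge sets has a common edge. -/

import Mathlib

/-- The (infinite) rectangular grid: the vertices are the integer points of the plane, and two of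
them are adjacent when they agree in one coordinate and differ by exactly one in the other. -/
def gridGraph : SimpleGraph (ℤ × ℤ) where
  Adj p q := (p.1 = q.1 ∧ |p.2 - q.2| = 1) ∨ (p.2 = q.2 ∧ |p.1 - q.1| = 1)
  symm := ⟨by
    rintro p q (⟨h, h'⟩ | ⟨h, h'⟩)
    · exact Or.inl ⟨h.symm, by rw [abs_sub_comm]; exact h'⟩
    · exact Or.inr ⟨h.symm, by rw [abs_sub_comm]; exact h'⟩⟩
  loopless := ⟨by
    rintro p (⟨-, h⟩ | ⟨-, h⟩) <;> simp at h⟩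

/-- The number of bends of a path of the grid: the number of pairs of consecutive steps of the
path that have different directions. -/
def gridBends {a b : ℤ × ℤ} (p : gridGraph.Walk a b) : ℕ :=
  ((Finset.range (p.length - 1)).filter fun i =>
    p.getVert (i + 2) - p.getVert (i + 1) ≠ p.getVert (i + 1) - p.getVert i).card

/-- The Helly property of a family of sets: every subfamily whose members pairwise intersect has
a common element. -/
def HellyProperty {ι α : Type*} (F : ι → Set α) : Prop :=
  ∀ S : Set ι, S.Nonempty → (S.Pairwise fun i j => (F i ∩ F j).Nonempty) →
    ∃ x, ∀ i ∈ S, x ∈ F i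

/-- An EPG representation of `G`: a nontrivial simple path of the grid for every vertex of `G`,
such that two distinct vertices are adjacent if and only if their paths share an edge of the
grid. -/
structure EPGRepresentation {V : Type*} (G : SimpleGraph V) where
  source : V → ℤ × ℤ
  target : V → ℤ × ℤ
  path : ∀ v, gridGraph.Walk (source v) (target v)
  isPath : ∀ v, (path v).IsPath
  length_pos : ∀ v, 0 < (path v).length
  adj_iff : ∀ u v, u ≠ v → (G.Adj u v ↔ ∃ e, e ∈ (path u).edges ∧ e ∈ (path v).edges)

/-- The set of grid edges covered by the path of the vertex `v`. -/
def EPGRepresentation.edgesOf {V : Type*} {G : SimpleGraph V} (R : EPGRepresentation G) (v : V) :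
    Set (Sym2 (ℤ × ℤ)) :=
  {e | e ∈ (R.path v).edges}

/-- `G` is Helly-`B_k`-EPG: it has an EPG representation in which every path has at most `k`
bends and in which the edge sets of the paths satisfy the Helly property. -/
def IsHellyBEPG {V : Type*} (k : ℕ) (G : SimpleGraph V) : Prop :=
  ∃ R : EPGRepresentation G, (∀ v, gridBends (R.path v) ≤ k) ∧ HellyProperty R.edgesOf

/-- A cactus: a connected graph in which any two distinct cycles have at most one vertex in
common. Closed walks that run through the same cycle from different starting points or in
different directions are identified by comparing the subgraphs they trace. -/
structure IsCactus {V : Type*} (G : SimpleGraph V) : Prop where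
  connected : G.Connected
  cycles : ∀ (u v : V) (p : G.Walk u u) (q : G.Walk v v), p.IsCycle → q.IsCycle →
    p.toSubgraph ≠ q.toSubgraph → (p.toSubgraph.verts ∩ q.toSubgraph.verts).Subsingleton

/-! A cactus grows from one vertex by attaching blocks: a leaf edge, or a cycle meeting the old set
`S` in one vertex `v`. The invariant `NoDetour` (no connection outside `S` joins two vertices of
`S`) makes this work: an edge `vw` leaving `S` is either a bridge or lies on a cycle, and since a
cactus has no ears or chords, that cycle without `v` is a pendant path and the invariant survives
(`IsCactus.set_induction`).

On the grid, every vertex keeps a private edge. To attach a block at `v`, the grid is scaled by `N`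
about the private edge of `v`. This edge becomes `N` private edges, and near it no other old corner
passes, so a gadget for the new path fits there; `v` keeps the last of the `N` edges
(`IsPendantPath.exists_model`).

Pairwise intersecting paths form a clique of `G`, so the Helly property only asks for a common edge
for each clique. Cliques with three vertices arise only from blocks that are triangles, whose gadget
has such an edge by design. -/

open SimpleGraph

/-! ### Decomposition of a cactus into blocks -/

section Cactus

variable {V : Type*} {G : SimpleGraph V}

/-- In a cactus, a cycle has no ear: a path that leaves a cycle along an edge which is not in the
cycle does not return to it at another vertex. -/
theorem IsCactus.no_ear (hG : IsCactus G) {r u v a : V} {c : G.Walk r r} (hc : c.IsCycle)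
    (hu : u ∈ c.support) (hv : v ∈ c.support) (huv : u ≠ v) (hua : G.Adj u a)
    (he : s(u, a) ∉ c.edges) (q : G.Walk a v)
    (hqc : ∀ x ∈ q.support, x ∈ c.support → x = v) : False := by
  classical
  wlog hq : q.IsPath generalizing q
  · exact this q.bypass (fun x hx => hqc x (q.support_bypass_subset_support hx))
      q.bypass_isPath
  have hc' : (c.rotate u hu).IsCycle := (Walk.isCycle_rotate hu).2 hc
  have hv' : v ∈ (c.rotate u hu).support := (c.mem_support_rotate_iff u hu).2 hv
  have harc : ((c.rotate u hu).dropUntil v hv').IsPath := by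
    refine Walk.IsCycle.isPath_of_append_right (p := (c.rotate u hu).takeUntil v hv') ?_ ?_
    · rw [Walk.nil_takeUntil]
      exact huv
    · rwa [Walk.take_spec]
  have harcs : ∀ x ∈ ((c.rotate u hu).dropUntil v hv').support, x ∈ c.support := fun x hx =>
    (c.mem_support_rotate_iff u hu).1 (Walk.support_dropUntil_subset_support _ hv' hx)
  have harce : ∀ e ∈ ((c.rotate u hu).dropUntil v hv').edges, e ∈ c.edges := fun e hx =>
    (c.rotate_edges u hu).mem_iff.1 (Walk.edges_dropUntil_subset_edges _ hv' hx)
  generalize (c.rotate u hu).dropUntil v hv' = arc at harc harcs harce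
  have hpath : (q.append arc).IsPath := by
    rw [Walk.isPath_def, Walk.support_append, List.nodup_append']
    refine ⟨hq.support_nodup, harc.support_nodup.tail, fun x hx hx' => ?_⟩
    have := hqc x hx (harcs x (List.mem_of_mem_tail hx'))
    subst this
    have h := harc.support_nodup
    rw [← Walk.cons_tail_support, List.nodup_cons] at h
    exact h.1 hx'
  have hcyc : (Walk.cons hua (q.append arc)).IsCycle := by
    rw [Walk.cons_isCycle_iff]
    refine ⟨hpath, fun h => ?_⟩
    rw [Walk.edges_append, List.mem_append] at h
    rcases h with h | h
    · exact huv (hqc u (Walk.fst_mem_support_of_mem_edges _ h) hu)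
    · exact he (harce _ h)
  refine huv (hG.cycles _ _ _ c hcyc hc (fun h => he ?_) ?_ ?_)
  · rw [← Walk.mem_edges_toSubgraph, ← h, Walk.mem_edges_toSubgraph]
    simp
  · simp [hu]
  · simp [hv]

/-- No path of `G` leaves the set `S` and returns to it at another vertex. -/
def NoDetour (G : SimpleGraph V) (S : Set V) : Prop :=
  ∀ ⦃u v a b : V⦄, u ∈ S → v ∈ S → G.Adj u a → G.Adj v b → ∀ p : G.Walk a b,
    (∀ x ∈ p.support, x ∉ S) → u = v

theorem SimpleGraph.Walk.exists_first_entry {S : Set V} {a x : V} (p : G.Walk a x) (ha : a ∉ S)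
    (hx : x ∈ S) : ∃ y z, y ∈ S ∧ y ∈ p.support ∧ G.Adj y z ∧
      ∃ q : G.Walk a z, ∀ t ∈ q.support, t ∉ S := by
  induction p with
  | nil => exact absurd hx ha
  | @cons a b x h p ih =>
    by_cases hb : b ∈ S
    · exact ⟨b, a, hb, by simp, h.symm, Walk.nil, by simpa using ha⟩
    · obtain ⟨y, z, hy, hyp, hyz, q, hq⟩ := ih hb hx
      refine ⟨y, z, hy, by simp [hyp], hyz, Walk.cons h q, ?_⟩
      simp only [Walk.support_cons, List.mem_cons]
      rintro t (rfl | ht)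
      · exact ha
      · exact hq t ht

/-- One step of the decomposition of a cactus: a path outside of `S`, all of whose vertices
have no other neighbours in `S` than `v`, which is adjacent exactly to its two ends. -/
structure IsPendantPath (G : SimpleGraph V) (S : Set V) (v : V) (k : ℕ) (w : ℕ → V) : Prop where
  mem : v ∈ S
  pos : 1 ≤ k
  notMem : ∀ i < k, w i ∉ S
  inj : ∀ i < k, ∀ j < k, w i = w j → i = j
  adj_base : ∀ u ∈ S, ∀ i < k, (G.Adj u (w i) ↔ u = v ∧ (i = 0 ∨ i + 1 = k))
  adj : ∀ i < k, ∀ j < k, (G.Adj (w i) (w j) ↔ i + 1 = j ∨ j + 1 = i)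

/-- A detour between `u ∈ S` and `w`, continued through `w` to `v`, forces `u = v`; it then joins
`w` to `v` without the edge `vw`, which is a bridge. -/
theorem NoDetour.insert_of_bridge {S : Set V} (hS : NoDetour G S) {v w : V} (hv : v ∈ S)
    (hw : w ∉ S) (hvw : G.Adj v w) (h : ¬ ∃ q : G.Walk w v, s(v, w) ∉ q.edges) :
    NoDetour G (insert w S) := by
  have key : ∀ ⦃u a b : V⦄, u ∈ S → G.Adj u a → G.Adj w b → ∀ p : G.Walk a b,
      (∀ x ∈ p.support, x ∉ insert w S) → False := by
    intro u a b hu hua hwb p hp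
    have hp' : ∀ x ∈ p.support, x ∉ S := fun x hx hxS => hp x hx (Or.inr hxS)
    have : u = v := by
      refine hS hu hv hua hvw (p.concat hwb.symm) fun x hx => ?_
      simp only [Walk.support_concat, List.mem_append, List.mem_singleton] at hx
      rcases hx with hx | rfl
      · exact hp' x hx
      · exact hw
    subst this
    refine h ⟨Walk.cons hwb (p.reverse.concat hua.symm), fun he => ?_⟩
    have hup : u ∉ p.support := fun hx => hp' u hx hv
    have hwp : w ∉ p.support := fun hx => hp w hx (Or.inl rfl)
    simp only [Walk.edges_cons, Walk.edges_concat, Walk.edges_reverse, List.mem_cons,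
      List.concat_eq_append, List.mem_append, List.mem_reverse, List.not_mem_nil, or_false,
      Sym2.eq_iff] at he
    rcases he with he | he | he
    · rcases he with ⟨rfl, -⟩ | ⟨rfl, -⟩
      · exact hw hv
      · exact hup p.end_mem_support
    · exact hup (Walk.fst_mem_support_of_mem_edges _ he)
    · rcases he with ⟨rfl, -⟩ | ⟨-, rfl⟩
      · exact hup p.start_mem_support
      · exact hwp p.start_mem_support
  rintro u u' a b hu hu' hua hub p hp
  rcases hu with rfl | hu <;> rcases hu' with rfl | hu'
  · rfl
  · exact (key hu' hub hua p.reverse (by simpa using hp)).elim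
  · exact (key hu hua hub p hp).elim
  · exact hS hu hu' hua hub p fun x hx hxS => hp x hx (Or.inr hxS)

section Cycle

variable {S : Set V} {v w : V} {q : G.Walk w v}

/-- The first entry of `q` into `S` must be `v`, and a path visits its end only once. -/
theorem NoDetour.eq_of_mem_support (hS : NoDetour G S) (hv : v ∈ S)
    (hw : w ∉ S) (hvw : G.Adj v w) (hq : q.IsPath) {x : V} (hx : x ∈ q.support) (hxS : x ∈ S) :
    x = v := by
  classical
  by_contra hxv
  obtain ⟨y, z, hy, hyq, hyz, p, hp⟩ := (q.takeUntil x hx).exists_first_entry hw hxS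
  have := hS hv hy hvw hyz p hp
  subst this
  exact Walk.endpoint_notMem_support_takeUntil hq hx (Ne.symm hxv) hyq

theorem NoDetour.exists_walk (hS : NoDetour G S) (hv : v ∈ S)
    (hw : w ∉ S) (hvw : G.Adj v w) (hq : q.IsPath) {x : V} (hx : x ∈ q.support) (hxv : x ≠ v) :
    ∃ p : G.Walk w x, ∀ t ∈ p.support, t ∉ S := by
  classical
  refine ⟨q.takeUntil x hx, fun t ht htS => ?_⟩
  have := hS.eq_of_mem_support hv hw hvw hq (Walk.support_takeUntil_subset_support _ hx ht) htS
  subst this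
  exact Walk.endpoint_notMem_support_takeUntil hq hx (Ne.symm hxv) ht

theorem IsCactus.mem_edges_of_adj (hG : IsCactus G) {r u v : V} {c : G.Walk r r}
    (hc : c.IsCycle) (hu : u ∈ c.support) (hv : v ∈ c.support) (huv : G.Adj u v) :
    s(u, v) ∈ c.edges := by
  by_contra he
  exact hG.no_ear hc hu hv huv.ne huv he Walk.nil (by simp)

/-- A detour between two vertices of the cycle is an ear. One between `u ∈ S` and a vertex of the
cycle other than `v` extends along `q` to `w`, so `u = v` and it is an ear again. -/
theorem IsCactus.noDetour_union (hG : IsCactus G) (hS : NoDetour G S) (hv : v ∈ S)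
    (hw : w ∉ S) (hvw : G.Adj v w) (hq : q.IsPath) (he : s(v, w) ∉ q.edges) :
    NoDetour G (S ∪ {x | x ∈ q.support}) := by
  have hc : (Walk.cons hvw q).IsCycle := (Walk.cons_isCycle_iff _ _).2 ⟨hq, he⟩
  have both : ∀ ⦃u u' a b : V⦄, u ∈ q.support → u' ∈ q.support → G.Adj u a → G.Adj u' b →
      ∀ p : G.Walk a b, (∀ x ∈ p.support, x ∉ S ∪ {x | x ∈ q.support}) → u = u' := by
    intro u u' a b hu hu' hua hub p hp
    by_contra huu
    refine hG.no_ear hc (by simp [hu]) (by simp [hu'] : u' ∈ _) huu hua (fun h => ?_)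
      (p.concat hub.symm) fun x hx hxc => ?_
    · have h1 := Walk.snd_mem_support_of_mem_edges _ h
      have h2 := hp a p.start_mem_support
      simp only [Walk.support_cons, List.mem_cons] at h1
      rcases h1 with rfl | h1
      · exact h2 (Or.inl hv)
      · exact h2 (Or.inr h1)
    · simp only [Walk.support_concat, List.mem_append, List.mem_singleton] at hx
      rcases hx with hx | rfl
      · have h2 := hp x hx
        simp only [Walk.support_cons, List.mem_cons] at hxc
        rcases hxc with rfl | hxc
        · exact (h2 (Or.inl hv)).elim
        · exact (h2 (Or.inr hxc)).elim
      · rfl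
  have mixed : ∀ ⦃u u' a b : V⦄, u ∈ S → u' ∈ q.support → G.Adj u a → G.Adj u' b →
      ∀ p : G.Walk a b, (∀ x ∈ p.support, x ∉ S ∪ {x | x ∈ q.support}) → u = u' := by
    intro u u' a b hu hu' hua hub p hp
    have hp' : ∀ x ∈ p.support, x ∉ S := fun x hx hxS => hp x hx (Or.inl hxS)
    by_cases h : u' = v
    · subst h
      exact hS hu hv hua hub p hp'
    · obtain ⟨p', hp1⟩ := hS.exists_walk hv hw hvw hq hu' h
      have : u = v := by
        refine hS hu hv hua hvw (p.append (Walk.cons hub.symm p'.reverse)) fun x hx => ?_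
        rw [Walk.mem_support_append_iff, Walk.support_cons, List.mem_cons,
          Walk.support_reverse, List.mem_reverse] at hx
        rcases hx with hx | rfl | hx
        · exact hp' x hx
        · exact hp' x p.end_mem_support
        · exact hp1 x hx
      subst this
      exact both q.end_mem_support hu' hua hub p hp
  rintro u u' a b (hu | hu) (hu' | hu') hua hub p hp
  · exact hS hu hu' hua hub p fun x hx hxS => hp x hx (Or.inl hxS)
  · exact mixed hu hu' hua hub p hp
  · exact (mixed hu' hu hub hua p.reverse (by simpa using hp)).symm
  · exact both hu hu' hua hub p hp

theorem IsCactus.isPendantPath_getVert (hG : IsCactus G) (hS : NoDetour G S) (hv : v ∈ S)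
    (hw : w ∉ S) (hvw : G.Adj v w) (hq : q.IsPath) (he : s(v, w) ∉ q.edges) :
    IsPendantPath G S v q.length q.getVert := by
  have hc : (Walk.cons hvw q).IsCycle := (Walk.cons_isCycle_iff _ _).2 ⟨hq, he⟩
  have hne : w ≠ v := by rintro rfl; exact hw hv
  have hinj : ∀ i ≤ q.length, ∀ j ≤ q.length, q.getVert i = q.getVert j → i = j :=
    fun i hi j hj h => hq.getVert_injOn hi hj h
  have hnv : ∀ i < q.length, q.getVert i ≠ v := fun i hi h => by
    have := hinj i hi.le q.length le_rfl (by simpa using h)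
    omega
  have hmem : ∀ i ≤ q.length, ∀ j ≤ q.length, s(q.getVert i, q.getVert j) ∈ q.edges →
      i + 1 = j ∨ j + 1 = i := by
    intro i hi j hj h
    rw [Walk.mk_mem_edges_iff_exists] at h
    obtain ⟨m, hm, h⟩ := h
    rw [Sym2.eq_iff] at h
    rcases h with ⟨h1, h2⟩ | ⟨h1, h2⟩
    · have := hinj _ hi _ (by omega) h1.symm
      have := hinj _ hj _ (by omega) h2.symm
      omega
    · have := hinj _ hj _ (by omega) h1.symm
      have := hinj _ hi _ (by omega) h2.symm
      omega
  refine ⟨hv, ?_, fun i hi h => ?_, fun i hi j hj h => hinj i hi.le j hj.le h, ?_, ?_⟩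
  · rcases Nat.eq_zero_or_pos q.length with h | h
    · exact absurd (Walk.eq_of_length_eq_zero h) hne
    · exact h
  · exact hnv i hi (hS.eq_of_mem_support hv hw hvw hq (q.getVert_mem_support i) h)
  · intro u hu i hi
    constructor
    · intro h
      obtain ⟨p, hp⟩ := hS.exists_walk hv hw hvw hq (q.getVert_mem_support i) (hnv i hi)
      have huv : v = u := hS hv hu hvw h p hp
      subst huv
      refine ⟨rfl, ?_⟩
      have := hG.mem_edges_of_adj hc (by simp) (by simp [q.getVert_mem_support i]) h
      rw [Walk.edges_cons, List.mem_cons] at this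
      rcases this with h' | h'
      -- The two edges of the cycle at `v` are the closing edge `vw`, giving `i = 0`, and the last
      -- edge of `q`, giving `i + 1 = k`.
      · rw [Sym2.congr_right] at h'
        exact Or.inl (hinj i hi.le 0 (by omega) (by simpa using h'))
      · have := hmem q.length le_rfl i hi.le (by simpa using h')
        omega
    · rintro ⟨rfl, rfl | h⟩
      · simpa using hvw
      · have := q.adj_getVert_succ hi
        rw [h, Walk.getVert_length] at this
        exact this.symm
  · intro i hi j hj
    constructor
    · intro h
      have := hG.mem_edges_of_adj hc (by simp [q.getVert_mem_support i])
        (by simp [q.getVert_mem_support j]) h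
      rw [Walk.edges_cons, List.mem_cons] at this
      rcases this with h' | h'
      · rw [Sym2.eq_iff] at h'
        rcases h' with ⟨h', -⟩ | ⟨-, h'⟩
        · exact absurd h' (hnv i hi)
        · exact absurd h' (hnv j hj)
      · exact hmem i hi.le j hj.le h'
    · rintro (rfl | rfl)
      · exact q.adj_getVert_succ hi
      · exact (q.adj_getVert_succ hj).symm

end Cycle

/-- Induction along the blocks of a finite cactus. -/
theorem IsCactus.set_induction [Finite V] (hG : IsCactus G) {P : Set V → Prop}
    (single : ∀ r, P {r})
    (step : ∀ S v k w, IsPendantPath G S v k w → P S → P (S ∪ w '' {i | i < k})) :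
    P Set.univ := by
  obtain ⟨r⟩ := hG.connected.nonempty
  have hr : NoDetour G {r} := by
    rintro u v a b rfl hv - - - -
    exact hv.symm
  -- If a maximal such `S` is not everything, an edge `vw` leaves it, and the block of that edge can
  -- be added.
  obtain ⟨S, ⟨hP, hS, hne⟩, hmax⟩ := (Set.toFinite {S : Set V | P S ∧ NoDetour G S ∧
    S.Nonempty}).exists_maximal ⟨{r}, single r, hr, Set.singleton_nonempty r⟩
  suffices S = Set.univ from this ▸ hP
  by_contra hun
  obtain ⟨z, hz⟩ := (Set.ne_univ_iff_exists_notMem S).1 hun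
  obtain ⟨y, hy⟩ := hne
  obtain ⟨p⟩ := hG.connected.preconnected y z
  obtain ⟨d, -, hv, hw⟩ := p.exists_boundary_dart S hy hz
  have hvw := d.adj
  generalize d.fst = v at hv hvw
  generalize d.snd = w at hw hvw
  by_cases h : ∃ q : G.Walk w v, s(v, w) ∉ q.edges
  · classical
    obtain ⟨q', hq'⟩ := h
    obtain ⟨q, hq, he⟩ : ∃ q : G.Walk w v, q.IsPath ∧ s(v, w) ∉ q.edges :=
      ⟨q'.bypass, q'.bypass_isPath, fun h => hq' (q'.edges_bypass_subset_edges h)⟩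
    have hpp := hG.isPendantPath_getVert hS hv hw hvw hq he
    have heq : S ∪ q.getVert '' {i | i < q.length} = S ∪ {x | x ∈ q.support} := by
      ext x
      simp only [Set.mem_union, Set.mem_image, Set.mem_ofPred_eq,
        Walk.mem_support_iff_exists_getVert]
      constructor
      · rintro (hx | ⟨i, hi, rfl⟩)
        · exact Or.inl hx
        · exact Or.inr ⟨i, rfl, hi.le⟩
      · rintro (hx | ⟨i, rfl, hi⟩)
        · exact Or.inl hx
        · rcases hi.lt_or_eq with hi | rfl
          · exact Or.inr ⟨i, hi, rfl⟩
          · exact Or.inl (by simpa using hv)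
    exact hw (hmax ⟨heq ▸ step S v _ _ hpp hP, hG.noDetour_union hS hv hw hvw hq he,
      ⟨v, Or.inl hv⟩⟩ Set.subset_union_left (Or.inr q.start_mem_support))
  · have hpp : IsPendantPath G S v 1 (fun _ => w) := by
      refine ⟨hv, le_rfl, fun _ _ => hw, fun i hi j hj _ => by omega, fun u hu i hi => ?_,
        fun i hi j hj => ?_⟩
      · constructor
        · intro h
          exact ⟨hS hu hv h hvw Walk.nil (by simpa using hw), by omega⟩
        · rintro ⟨rfl, -⟩
          exact hvw
      · constructor
        · intro h
          exact (h.ne rfl).elim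
        · omega
    have heq : S ∪ (fun _ => w) '' {i | i < 1} = insert w S := by
      ext x
      simp [eq_comm]
    exact hw (hmax ⟨heq ▸ step S v _ _ hpp hP, hS.insert_of_bridge hv hw hvw h,
      ⟨v, Or.inr hv⟩⟩ (Set.subset_insert w S) (Set.mem_insert w S))

end Cactus

/-! ### Corners as grid walks -/

theorem SimpleGraph.exists_walk_getVert_eq {V : Type*} {G : SimpleGraph V} (n : ℕ) (γ : ℕ → V)
    (h : ∀ i < n, G.Adj (γ i) (γ (i + 1))) :
    ∃ p : G.Walk (γ 0) (γ n), p.length = n ∧ ∀ i ≤ n, p.getVert i = γ i := by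
  induction n generalizing γ with
  | zero => exact ⟨Walk.nil, rfl, fun i hi => by simp [Nat.le_zero.1 hi]⟩
  | succ n ih =>
    obtain ⟨p, hp, hp'⟩ := ih (fun i => γ (i + 1)) fun i hi => h (i + 1) (by omega)
    refine ⟨Walk.cons (h 0 (by omega)) p, by simp [hp], fun i hi => ?_⟩
    rcases i with _ | i
    · simp
    · rw [Walk.getVert_cons_succ]
      exact hp' i (by omega)

/-- A grid path with at most one bend: it runs along the row `y` from `(a, y)` to `(x, y)`, and
from there along the column `x` to `(x, b)`. -/
structure Corner where
  x : ℤ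
  y : ℤ
  a : ℤ
  b : ℤ

/-- The corner covers the edge of direction `d` (`true` for horizontal) whose lower left end is
`(i, j)`. -/
def Corner.Covers (s : Corner) (d : Bool) (i j : ℤ) : Prop :=
  if d then j = s.y ∧ min s.x s.a ≤ i ∧ i < max s.x s.a
  else i = s.x ∧ min s.y s.b ≤ j ∧ j < max s.y s.b

theorem Corner.covers_true {s : Corner} {i j : ℤ} :
    s.Covers true i j ↔ j = s.y ∧ min s.x s.a ≤ i ∧ i < max s.x s.a := by
  simp [Corner.Covers]

theorem Corner.covers_false {s : Corner} {i j : ℤ} :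
    s.Covers false i j ↔ i = s.x ∧ min s.y s.b ≤ j ∧ j < max s.y s.b := by
  simp [Corner.Covers]

/-- The edge of direction `d` (`true` for horizontal) whose lower left end is `(i, j)`. -/
def gridEdge (d : Bool) (i j : ℤ) : Sym2 (ℤ × ℤ) :=
  if d then s((i, j), (i + 1, j)) else s((i, j), (i, j + 1))

theorem gridEdge_inj {d d' : Bool} {i j i' j' : ℤ} :
    gridEdge d i j = gridEdge d' i' j' ↔ d = d' ∧ i = i' ∧ j = j' := by
  cases d <;> cases d' <;>
    simp only [gridEdge, if_true, if_false, Bool.false_eq_true, Sym2.eq_iff, Prod.mk.injEq,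
      reduceCtorEq, true_and, false_and, iff_false] <;> omega

theorem gridBends_le_one {u v : ℤ × ℤ} (p : gridGraph.Walk u v) (n : ℕ)
    (h : ∀ i, i + 2 ≤ p.length → i + 1 ≠ n →
      p.getVert (i + 2) - p.getVert (i + 1) = p.getVert (i + 1) - p.getVert i) :
    gridBends p ≤ 1 := by
  refine Finset.card_le_one.2 fun i hi j hj => ?_
  simp only [Finset.mem_filter, Finset.mem_range] at hi hj
  have h1 : i + 1 = n := by
    by_contra hn
    exact hi.2 (h i (by omega) hn)
  have h2 : j + 1 = n := by
    by_contra hn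
    exact hj.2 (h j (by omega) hn)
  omega

/-- The `i`-th point of the path that makes `n` steps of direction `σ` in a row and then
steps of direction `τ` in a column. -/
def cornerPoint (a y σ τ : ℤ) (n i : ℕ) : ℤ × ℤ :=
  (a + σ * (min i n : ℕ), y + τ * (i - n : ℕ))

theorem cornerPoint_adj {a y σ τ : ℤ} (hσ : σ = 1 ∨ σ = -1) (hτ : τ = 1 ∨ τ = -1) (n i : ℕ) :
    gridGraph.Adj (cornerPoint a y σ τ n i) (cornerPoint a y σ τ n (i + 1)) := by
  simp only [gridGraph, cornerPoint, abs_eq (zero_le_one' ℤ)]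
  rcases hσ with rfl | rfl <;> rcases hτ with rfl | rfl <;> omega

theorem cornerPoint_inj {a y σ τ : ℤ} (hσ : σ = 1 ∨ σ = -1) (hτ : τ = 1 ∨ τ = -1) {n i j : ℕ}
    (h : cornerPoint a y σ τ n i = cornerPoint a y σ τ n j) : i = j := by
  simp only [cornerPoint, Prod.mk.injEq] at h
  rcases hσ with rfl | rfl <;> rcases hτ with rfl | rfl <;> omega

/-- The truncated terms `min i n` and `i - n` change slope only at `i = n`, the one possible bend.
-/
theorem cornerPoint_sub {a y σ τ : ℤ} {n i : ℕ} (hi : i + 1 ≠ n) :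
    cornerPoint a y σ τ n (i + 2) - cornerPoint a y σ τ n (i + 1) =
      cornerPoint a y σ τ n (i + 1) - cornerPoint a y σ τ n i := by
  rcases lt_or_gt_of_ne hi with h | h
  · have h1 : min (i + 2) n = i + 2 := by omega
    have h2 : min (i + 1) n = i + 1 := by omega
    have h3 : min i n = i := by omega
    have h4 : i + 2 - n = 0 := by omega
    have h5 : i + 1 - n = 0 := by omega
    have h6 : i - n = 0 := by omega
    simp only [cornerPoint, h1, h2, h3, h4, h5, h6, Prod.mk_sub_mk, Prod.mk.injEq]
    push_cast
    exact ⟨by ring, trivial⟩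
  · obtain ⟨m, rfl⟩ : ∃ m, i = n + m := ⟨i - n, by omega⟩
    have h1 : min (n + m + 2) n = n := by omega
    have h2 : min (n + m + 1) n = n := by omega
    have h3 : min (n + m) n = n := by omega
    have h4 : n + m + 2 - n = m + 2 := by omega
    have h5 : n + m + 1 - n = m + 1 := by omega
    have h6 : n + m - n = m := by omega
    simp only [cornerPoint, h1, h2, h3, h4, h5, h6, Prod.mk_sub_mk, Prod.mk.injEq]
    push_cast
    exact ⟨trivial, by ring⟩

theorem exists_cornerPoint_edge {a y σ τ : ℤ} (hσ : σ = 1 ∨ σ = -1) (hτ : τ = 1 ∨ τ = -1)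
    (n m : ℕ) (e : Sym2 (ℤ × ℤ)) :
    (∃ i < n + m, s(cornerPoint a y σ τ n i, cornerPoint a y σ τ n (i + 1)) = e) ↔
      ∃ d i j, (Corner.mk (a + σ * n) y a (y + τ * m)).Covers d i j ∧ gridEdge d i j = e := by
  constructor
  · rintro ⟨k, hk, rfl⟩
    by_cases hkn : k < n
    -- For the sign `-1` the lower left end of an edge is its later point, hence the minimum.
    · refine ⟨true, a + min (σ * k) (σ * (k + 1)), y, Corner.covers_true.2 ?_, ?_⟩
      · dsimp only
        rcases hσ with rfl | rfl <;> omega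
      · simp only [gridEdge, if_true, cornerPoint, Sym2.eq_iff, Prod.mk.injEq]
        rcases hσ with rfl | rfl <;> rcases hτ with rfl | rfl <;> omega
    · refine ⟨false, a + σ * n, y + min (τ * (k - n)) (τ * (k - n + 1)),
        Corner.covers_false.2 ?_, ?_⟩
      · dsimp only
        rcases hτ with rfl | rfl <;> omega
      · simp only [gridEdge, Bool.false_eq_true, if_false, cornerPoint, Sym2.eq_iff,
          Prod.mk.injEq]
        rcases hσ with rfl | rfl <;> rcases hτ with rfl | rfl <;> omega
  · rintro ⟨d, i, j, h, rfl⟩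
    cases d
    · rw [Corner.covers_false] at h
      dsimp only at h
      refine ⟨n + (min (τ * (j - y)) (τ * (j + 1 - y))).toNat, ?_, ?_⟩
      · rcases hτ with rfl | rfl <;> omega
      · simp only [gridEdge, Bool.false_eq_true, if_false, cornerPoint, Sym2.eq_iff,
          Prod.mk.injEq]
        rcases hσ with rfl | rfl <;> rcases hτ with rfl | rfl <;> omega
    · rw [Corner.covers_true] at h
      dsimp only at h
      refine ⟨(min (σ * (i - a)) (σ * (i + 1 - a))).toNat, ?_, ?_⟩
      · rcases hσ with rfl | rfl <;> omega
      · simp only [gridEdge, if_true, cornerPoint, Sym2.eq_iff, Prod.mk.injEq]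
        rcases hσ with rfl | rfl <;> rcases hτ with rfl | rfl <;> omega

theorem exists_sign_mul_natCast (z : ℤ) : ∃ σ : ℤ, ∃ n : ℕ, (σ = 1 ∨ σ = -1) ∧ z = σ * n := by
  rcases le_total 0 z with h | h
  · exact ⟨1, z.toNat, Or.inl rfl, by omega⟩
  · exact ⟨-1, (-z).toNat, Or.inr rfl, by omega⟩

theorem Corner.exists_walk (s : Corner) :
    ∃ p : gridGraph.Walk (s.a, s.y) (s.x, s.b), p.IsPath ∧ gridBends p ≤ 1 ∧
      ∀ e, e ∈ p.edges ↔ ∃ d i j, s.Covers d i j ∧ gridEdge d i j = e := by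
  obtain ⟨x, y, a, b⟩ := s
  obtain ⟨σ, n, hσ, hn⟩ := exists_sign_mul_natCast (x - a)
  obtain ⟨τ, m, hτ, hm⟩ := exists_sign_mul_natCast (b - y)
  obtain rfl : x = a + σ * n := by omega
  obtain rfl : b = y + τ * m := by omega
  obtain ⟨p, hp, hp'⟩ := exists_walk_getVert_eq (n + m) (cornerPoint a y σ τ n)
    fun i _ => cornerPoint_adj hσ hτ n i
  have h0 : cornerPoint a y σ τ n 0 = (a, y) := by simp [cornerPoint]
  have h1 : cornerPoint a y σ τ n (n + m) = (a + σ * n, y + τ * m) := by simp [cornerPoint]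
  refine ⟨p.copy h0 h1, ?_, ?_, fun e => ?_⟩
  · rw [Walk.isPath_copy, ← Walk.IsPath.getVert_injOn_iff]
    intro i hi j hj h
    rw [hp' i (hp ▸ hi), hp' j (hp ▸ hj)] at h
    exact cornerPoint_inj hσ hτ h
  · refine gridBends_le_one _ n fun i hi hin => ?_
    rw [Walk.length_copy, hp] at hi
    simp only [Walk.getVert_copy]
    rw [hp' _ hi, hp' (i + 1) (by omega), hp' i (by omega)]
    exact cornerPoint_sub hin
  · rw [Walk.edges_copy, ← exists_cornerPoint_edge hσ hτ]
    induction e with | _ u v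
    rw [Walk.mk_mem_edges_iff_exists]
    constructor
    · rintro ⟨i, hi, h⟩
      rw [hp' i (by omega), hp' (i + 1) (by omega)] at h
      exact ⟨i, by omega, h⟩
    · rintro ⟨i, hi, h⟩
      refine ⟨i, by omega, ?_⟩
      rw [hp' i (by omega), hp' (i + 1) (by omega)]
      exact h

/-! ### Models by corners, reflection and scaling -/

/-- The edges of the grid covered by a corner, given by their direction and lower left end. -/
def Corner.edges (s : Corner) : Set (Bool × ℤ × ℤ) :=
  {e | s.Covers e.1 e.2.1 e.2.2}

theorem Corner.true_mem_edges {s : Corner} {i j : ℤ} :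
    (true, i, j) ∈ s.edges ↔ j = s.y ∧ min s.x s.a ≤ i ∧ i < max s.x s.a :=
  Corner.covers_true

theorem Corner.false_mem_edges {s : Corner} {i j : ℤ} :
    (false, i, j) ∈ s.edges ↔ i = s.x ∧ min s.y s.b ≤ j ∧ j < max s.y s.b :=
  Corner.covers_false

/-- The sets `F u` represent the subgraph of `G` induced on `S` as an intersection graph, with an
element of its own for every vertex and a common element for every clique. -/
structure IsHellyModel {V α : Type*} (G : SimpleGraph V) (S : Set V) (F : V → Set α) :
    Prop where
  adj : ∀ u ∈ S, ∀ v ∈ S, u ≠ v → (G.Adj u v ↔ ∃ e, e ∈ F u ∧ e ∈ F v)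
  exists_own : ∀ v ∈ S, ∃ e ∈ F v, ∀ u ∈ S, u ≠ v → e ∉ F u
  clique : ∀ T ⊆ S, T.Nonempty → T.Pairwise G.Adj → ∃ e, ∀ u ∈ T, e ∈ F u

/-- The maps need not be inverse to each other: in a scaling, `ψ` collapses the `N` pieces of an
edge and `φ` picks one of them. -/
theorem IsHellyModel.transfer {V α β : Type*} {G : SimpleGraph V} {S : Set V} {F : V → Set α}
    (hF : IsHellyModel G S F) {F' : V → Set β} (φ : α → β) (ψ : β → α)
    (hφ : ∀ u e, φ e ∈ F' u ↔ e ∈ F u) (hψ : ∀ u e, e ∈ F' u → ψ e ∈ F u) :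
    IsHellyModel G S F' where
  adj u hu v hv huv := by
    rw [hF.adj u hu v hv huv]
    exact ⟨fun ⟨e, h1, h2⟩ => ⟨φ e, (hφ u e).2 h1, (hφ v e).2 h2⟩,
      fun ⟨e, h1, h2⟩ => ⟨ψ e, hψ u e h1, hψ v e h2⟩⟩
  exists_own v hv := by
    obtain ⟨e, h1, h2⟩ := hF.exists_own v hv
    exact ⟨φ e, (hφ v e).2 h1, fun u hu huv h => h2 u hu huv ((hφ u e).1 h)⟩
  clique T hT hne hadj := by
    obtain ⟨e, he⟩ := hF.clique T hT hne hadj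
    exact ⟨φ e, fun u hu => (hφ u e).2 (he u hu)⟩

/-- The reflection of a corner in the diagonal. -/
def Corner.swap (s : Corner) : Corner := ⟨s.y, s.x, s.b, s.a⟩

/-- The image of a corner under the homothety of ratio `N` that takes `(i, j)` to the origin. -/
def Corner.scale (N i j : ℤ) (s : Corner) : Corner :=
  ⟨N * (s.x - i), N * (s.y - j), N * (s.a - i), N * (s.b - j)⟩

section CornerModel

variable {V : Type*} {G : SimpleGraph V} {S : Set V}

theorem Corner.mem_edges_swap {s : Corner} {d : Bool} {i j : ℤ} :
    (d, i, j) ∈ s.swap.edges ↔ (!d, j, i) ∈ s.edges := by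
  cases d <;> simp [Corner.swap, Corner.true_mem_edges, Corner.false_mem_edges]

theorem IsHellyModel.swap {f : V → Corner} (hf : IsHellyModel G S fun u => (f u).edges) :
    IsHellyModel G S fun u => (f u).swap.edges :=
  hf.transfer (fun e => (!e.1, e.2.2, e.2.1)) (fun e => (!e.1, e.2.2, e.2.1))
    (fun u e => by rw [Corner.mem_edges_swap, Bool.not_not])
    (fun u e he => Corner.mem_edges_swap.1 he)

theorem mul_min_le_iff_and_lt_mul_max {N : ℤ} (hN : 0 < N) (x a t p : ℤ) :
    (min (N * (x - t)) (N * (a - t)) ≤ p ∧ p < max (N * (x - t)) (N * (a - t))) ↔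
      min x a ≤ p / N + t ∧ p / N + t < max x a := by
  have h1 : ∀ z, N * z ≤ p ↔ z ≤ p / N := fun z => by
    rw [Int.le_ediv_iff_mul_le hN, mul_comm]
  have h2 : ∀ z, p < N * z ↔ p / N < z := fun z => by
    rw [Int.ediv_lt_iff_lt_mul hN, mul_comm]
  simp only [min_le_iff, lt_max_iff, h1, h2]
  omega

theorem eq_mul_sub_iff {N : ℤ} (hN : 0 < N) (y t q : ℤ) :
    q = N * (y - t) ↔ N ∣ q ∧ q / N + t = y := by
  constructor
  · rintro rfl
    exact ⟨dvd_mul_right _ _, by rw [Int.mul_ediv_cancel_left _ hN.ne']; ring⟩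
  · rintro ⟨⟨z, rfl⟩, rfl⟩
    rw [Int.mul_ediv_cancel_left _ hN.ne']
    ring

theorem Corner.true_mem_edges_scale {N : ℤ} (hN : 0 < N) {i j p q : ℤ} {s : Corner} :
    (true, p, q) ∈ (s.scale N i j).edges ↔ N ∣ q ∧ (true, p / N + i, q / N + j) ∈ s.edges := by
  rw [Corner.true_mem_edges, Corner.true_mem_edges]
  exact (and_congr (eq_mul_sub_iff hN _ _ _) (mul_min_le_iff_and_lt_mul_max hN _ _ _ _)).trans
    and_assoc

theorem Corner.false_mem_edges_scale {N : ℤ} (hN : 0 < N) {i j p q : ℤ} {s : Corner} :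
    (false, p, q) ∈ (s.scale N i j).edges ↔ N ∣ p ∧ (false, p / N + i, q / N + j) ∈ s.edges := by
  rw [Corner.false_mem_edges, Corner.false_mem_edges]
  exact (and_congr (eq_mul_sub_iff hN _ _ _) (mul_min_le_iff_and_lt_mul_max hN _ _ _ _)).trans
    and_assoc

theorem IsHellyModel.scale {f : V → Corner} (hf : IsHellyModel G S fun u => (f u).edges)
    {N : ℤ} (hN : 0 < N) (i j : ℤ) :
    IsHellyModel G S fun u => ((f u).scale N i j).edges := by
  refine hf.transfer (fun e => (e.1, N * (e.2.1 - i), N * (e.2.2 - j)))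
    (fun e => (e.1, e.2.1 / N + i, e.2.2 / N + j)) ?_ ?_
  · rintro u ⟨_ | _, p, q⟩
    · simp [Corner.false_mem_edges_scale hN, Int.mul_ediv_cancel_left _ hN.ne']
    · simp [Corner.true_mem_edges_scale hN, Int.mul_ediv_cancel_left _ hN.ne']
  · rintro u ⟨_ | _, p, q⟩ h
    · exact ((Corner.false_mem_edges_scale hN).1 h).2
    · exact ((Corner.true_mem_edges_scale hN).1 h).2

/-- A model by corners can be moved so that the vertex `v` owns the segment from `(0, 0)` to
`(N, 0)`, while all corners run in rows and columns whose number is a multiple of `N`. -/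
theorem IsHellyModel.exists_own_segment {f : V → Corner}
    (hf : IsHellyModel G S fun u => (f u).edges) {v : V} (hv : v ∈ S) {N : ℤ} (hN : 0 < N) :
    ∃ f' : V → Corner, IsHellyModel G S (fun u => (f' u).edges) ∧
      (∀ i, 0 ≤ i → i < N → (true, i, 0) ∈ (f' v).edges ∧
        ∀ u ∈ S, u ≠ v → (true, i, 0) ∉ (f' u).edges) ∧
      (∀ u i j, (true, i, j) ∈ (f' u).edges → N ∣ j) ∧
      ∀ u i j, (false, i, j) ∈ (f' u).edges → N ∣ i := by
  obtain ⟨⟨d, i, j⟩, h1, h2⟩ := hf.exists_own v hv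
  wlog hd : d = true generalizing f d i j
  · obtain rfl : d = false := by simpa using hd
    exact this hf.swap true j i (Corner.mem_edges_swap.2 h1)
      (fun u hu huv h => h2 u hu huv (Corner.mem_edges_swap.1 h)) rfl
  subst hd
  refine ⟨fun u => (f u).scale N i j, hf.scale hN i j, fun p hp hpN => ?_,
    fun u p q h => ((Corner.true_mem_edges_scale hN).1 h).1,
    fun u p q h => ((Corner.false_mem_edges_scale hN).1 h).1⟩
  simp only [Corner.true_mem_edges_scale hN, Int.ediv_eq_zero_of_lt hp hpN, dvd_zero, true_and,
    Int.zero_ediv, zero_add]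
  exact ⟨h1, h2⟩

/-! ### Gadgets for pendant paths -/

/-- Corners `g 0, …, g (k - 1)` that can be attached to a segment from `(0, 0)` to `(N, 0)`
in order to represent a pendant path. -/
structure IsGadget (k : ℕ) (N : ℤ) (g : ℕ → Corner) : Prop where
  row : ∀ i < k, ∀ p q, (true, p, q) ∈ (g i).edges → q = 1 ∨ q = 0 ∧ 0 ≤ p ∧ p < N - 1
  column : ∀ i < k, ∀ p q, (false, p, q) ∈ (g i).edges → 1 ≤ p ∧ p < N
  base : ∀ i < k, ((∃ p, (true, p, 0) ∈ (g i).edges) ↔ i = 0 ∨ i + 1 = k)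
  adj : ∀ i < k, ∀ j < k, i ≠ j →
    ((∃ d p q, (d, p, q) ∈ (g i).edges ∧ (d, p, q) ∈ (g j).edges) ↔ i + 1 = j ∨ j + 1 = i)
  own : ∀ i < k, ∃ d p q, (d, p, q) ∈ (g i).edges ∧ (d = true → q ≠ 0) ∧
    ∀ j < k, j ≠ i → (d, p, q) ∉ (g j).edges
  common : k = 2 → ∃ p, ∀ i < k, (true, p, 0) ∈ (g i).edges

theorem isGadget_one : IsGadget 1 2 fun _ => ⟨1, 0, 0, 1⟩ := by
  have hT : ∀ p q, (true, p, q) ∈ (Corner.mk 1 0 0 1).edges ↔ p = 0 ∧ q = 0 := by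
    intro p q
    rw [Corner.true_mem_edges]
    dsimp only
    omega
  have hF : ∀ p q, (false, p, q) ∈ (Corner.mk 1 0 0 1).edges ↔ p = 1 ∧ q = 0 := by
    intro p q
    rw [Corner.false_mem_edges]
    dsimp only
    omega
  refine ⟨fun i hi p q => ?_, fun i hi p q => ?_, fun i hi => ?_, fun i hi j hj => by omega,
    fun i hi => ⟨false, 1, 0, by simp [hF], by simp, fun j hj hij => by omega⟩,
    fun h => by omega⟩
  · rw [hT]
    omega
  · rw [hF]
    omega
  · exact ⟨fun _ => by omega, fun _ => ⟨0, by simp [hT]⟩⟩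

/-- Both corners share the edge from `(1, 0)` to `(2, 0)`, common to the whole triangle, and rise in
different columns. -/
theorem isGadget_two :
    IsGadget 2 3 fun i => if i = 0 then ⟨1, 0, 2, 1⟩ else ⟨2, 0, 1, 1⟩ := by
  set g : ℕ → Corner := fun i => if i = 0 then ⟨1, 0, 2, 1⟩ else ⟨2, 0, 1, 1⟩ with hg
  have hT : ∀ i p q, (true, p, q) ∈ (g i).edges ↔ p = 1 ∧ q = 0 := by
    intro i p q
    simp only [Corner.true_mem_edges, hg]
    split_ifs <;> dsimp only <;> omega
  have hF : ∀ i p q, (false, p, q) ∈ (g i).edges ↔ q = 0 ∧ (i = 0 ∧ p = 1 ∨ i ≠ 0 ∧ p = 2) := by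
    intro i p q
    simp only [Corner.false_mem_edges, hg]
    split_ifs <;> dsimp only <;> omega
  clear_value g
  refine ⟨?_, ?_, ?_, ?_, ?_, ?_⟩ <;> simp only [hT, hF, Bool.exists_bool, and_true]
  · omega
  · omega
  · exact fun i hi => ⟨fun _ => by omega, fun _ => ⟨1, by omega⟩⟩
  · exact fun i hi j hj hij => ⟨fun _ => by omega, fun _ => Or.inr ⟨1, 0, by omega⟩⟩
  · refine fun i hi => Or.inl ⟨i + 1, 0, by omega, by simp, fun j hj hij => by omega⟩
  · exact fun _ => ⟨1, by omega⟩

/-- The middle corner must meet both ends off row `0`, so all three use column `1`: one end goes up,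
the other down, and the middle overlaps both. -/
theorem isGadget_three : IsGadget 3 3 fun i =>
    if i = 0 then ⟨1, 0, 0, 2⟩ else if i = 1 then ⟨1, 1, 2, -1⟩ else ⟨1, 0, 2, -2⟩ := by
  set g : ℕ → Corner := fun i =>
    if i = 0 then ⟨1, 0, 0, 2⟩ else if i = 1 then ⟨1, 1, 2, -1⟩ else ⟨1, 0, 2, -2⟩ with hg
  have hT : ∀ i p q, (true, p, q) ∈ (g i).edges ↔
      i = 0 ∧ p = 0 ∧ q = 0 ∨ i = 1 ∧ p = 1 ∧ q = 1 ∨ 2 ≤ i ∧ p = 1 ∧ q = 0 := by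
    intro i p q
    simp only [Corner.true_mem_edges, hg]
    split_ifs <;> dsimp only <;> omega
  have hF : ∀ i p q, (false, p, q) ∈ (g i).edges ↔ p = 1 ∧
      (i = 0 ∧ 0 ≤ q ∧ q < 2 ∨ i = 1 ∧ -1 ≤ q ∧ q < 1 ∨ 2 ≤ i ∧ -2 ≤ q ∧ q < 0) := by
    intro i p q
    simp only [Corner.false_mem_edges, hg]
    split_ifs <;> dsimp only <;> omega
  clear_value g
  refine ⟨?_, ?_, ?_, ?_, ?_, ?_⟩ <;> simp only [hT, hF, Bool.exists_bool, and_true]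
  · omega
  · omega
  · exact fun i hi => ⟨fun ⟨p, _⟩ => by omega, fun _ => ⟨if i = 0 then 0 else 1, by omega⟩⟩
  · refine fun i hi j hj hij => ⟨?_, fun _ => Or.inl ⟨1, if i + j = 1 then 0 else -1, by omega⟩⟩
    rintro (⟨p, q, _⟩ | ⟨p, q, _⟩) <;> omega
  · intro i hi
    by_cases h1 : i = 1
    · exact Or.inr ⟨1, 1, by omega, by simp, fun j hj hij => by omega⟩
    · exact Or.inl ⟨1, if i = 0 then 1 else -2, by omega, by simp, fun j hj hij => by omega⟩
  · omega

/-- The inner corners form a chain in row `1`: intervals of length `3` with step `2` overlap in one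
edge, and the middle edge `2 * i` stays private. The first and last of them bend down to meet the
two end corners in columns. -/
theorem isGadget_of_four_le {k : ℕ} (hk : 4 ≤ k) : IsGadget k (2 * k) fun i =>
    if i = 0 then ⟨1, 0, 0, 2⟩
    else if i + 1 = k then ⟨2 * k - 2, 0, 2 * k - 3, 2⟩
    else if i = 1 then ⟨1, 1, 4, 0⟩
    else if i + 2 = k then ⟨2 * k - 2, 1, 2 * k - 5, 0⟩
    else ⟨2 * i - 1, 1, 2 * i + 2, 1⟩ := by
  set g : ℕ → Corner := fun i =>
    if i = 0 then ⟨1, 0, 0, 2⟩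
    else if i + 1 = k then ⟨2 * k - 2, 0, 2 * k - 3, 2⟩
    else if i = 1 then ⟨1, 1, 4, 0⟩
    else if i + 2 = k then ⟨2 * k - 2, 1, 2 * k - 5, 0⟩
    else ⟨2 * i - 1, 1, 2 * i + 2, 1⟩ with hg
  have hT : ∀ i p q, i < k → ((true, p, q) ∈ (g i).edges ↔
      i = 0 ∧ p = 0 ∧ q = 0 ∨ i + 1 = k ∧ p = 2 * k - 3 ∧ q = 0 ∨
      1 ≤ i ∧ i + 2 ≤ k ∧ q = 1 ∧ 2 * i - 1 ≤ p ∧ p < 2 * i + 2) := by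
    intro i p q hi
    simp only [Corner.true_mem_edges, hg]
    split_ifs <;> dsimp only <;> omega
  have hF : ∀ i p q, i < k → ((false, p, q) ∈ (g i).edges ↔
      i = 0 ∧ p = 1 ∧ 0 ≤ q ∧ q < 2 ∨ i + 1 = k ∧ p = 2 * k - 2 ∧ 0 ≤ q ∧ q < 2 ∨
      i = 1 ∧ p = 1 ∧ q = 0 ∨ i + 2 = k ∧ p = 2 * k - 2 ∧ q = 0) := by
    intro i p q hi
    simp only [Corner.false_mem_edges, hg]
    split_ifs <;> dsimp only <;> omega
  clear_value g
  refine ⟨fun i hi p q => ?_, fun i hi p q => ?_, fun i hi => ?_, fun i hi j hj hij => ?_,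
    fun i hi => ?_, fun h => by omega⟩
  · rw [hT i p q hi]
    omega
  · rw [hF i p q hi]
    omega
  · simp only [hT i _ _ hi, and_true, zero_ne_one, false_and, and_false, or_false]
    exact ⟨fun ⟨p, _⟩ => by omega, fun _ => ⟨if i = 0 then 0 else 2 * k - 3, by omega⟩⟩
  · simp only [hT i _ _ hi, hF i _ _ hi, hT j _ _ hj, hF j _ _ hj, Bool.exists_bool]
    constructor
    · rintro (⟨p, q, _⟩ | ⟨p, q, _⟩) <;> omega
    · intro h
      by_cases h0 : i + j = 1
      · exact Or.inl ⟨1, 0, by omega⟩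
      · by_cases h1 : i + j + 3 = 2 * k
        · exact Or.inl ⟨2 * k - 2, 0, by omega⟩
        · exact Or.inr ⟨i + j, 1, by omega⟩
  · by_cases h0 : i = 0 ∨ i + 1 = k
    · refine ⟨false, if i = 0 then 1 else 2 * k - 2, 1, ?_, by simp, fun j hj hij => ?_⟩
      · rw [hF i _ _ hi]
        omega
      · rw [hF j _ _ hj]
        omega
    · refine ⟨true, 2 * i, 1, ?_, by simp, fun j hj hij => ?_⟩
      · rw [hT i _ _ hi]
        omega
      · rw [hT j _ _ hj]
        omega

theorem exists_isGadget {k : ℕ} (hk : 1 ≤ k) : ∃ N g, 2 ≤ N ∧ IsGadget k N g := by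
  obtain rfl | rfl | rfl | h : k = 1 ∨ k = 2 ∨ k = 3 ∨ 4 ≤ k := by omega
  · exact ⟨_, _, by omega, isGadget_one⟩
  · exact ⟨_, _, by omega, isGadget_two⟩
  · exact ⟨_, _, by omega, isGadget_three⟩
  · exact ⟨_, _, by omega, isGadget_of_four_le h⟩

/-! ### Attaching a gadget to a model -/

theorem IsPendantPath.exists_extension {v : V} {k : ℕ} {w : ℕ → V}
    (hw : IsPendantPath G S v k w) {α : Type*} (f : V → α) (g : ℕ → α) :
    ∃ f' : V → α, (∀ u ∈ S, f' u = f u) ∧ ∀ i < k, f' (w i) = g i := by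
  classical
  refine ⟨fun u => if h : ∃ i, i < k ∧ w i = u then g h.choose else f u, fun u hu => ?_,
    fun i hi => ?_⟩
  · refine dif_neg ?_
    rintro ⟨i, hi, rfl⟩
    exact hw.notMem i hi hu
  · have h : ∃ j, j < k ∧ w j = w i := ⟨i, hi, rfl⟩
    exact (dif_pos h).trans (congrArg g (hw.inj _ h.choose_spec.1 _ hi h.choose_spec.2))

theorem IsPendantPath.exists_model {v : V} {k : ℕ} {w : ℕ → V} (hw : IsPendantPath G S v k w)
    (hS : ∃ f : V → Corner, IsHellyModel G S fun u => (f u).edges) :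
    ∃ f : V → Corner, IsHellyModel G (S ∪ w '' {i | i < k}) fun u => (f u).edges := by
  obtain ⟨f₀, hf₀⟩ := hS
  obtain ⟨N, g, hN, hg⟩ := exists_isGadget hw.pos
  obtain ⟨f, hf, hseg, hrow, hcol⟩ := hf₀.exists_own_segment hw.mem (by omega : 0 < N)
  obtain ⟨F, hFS, hFw⟩ := hw.exists_extension f g
  -- Neither row `1` nor the columns `1, …, N - 1` are multiples of `N`, so old corners meet the
  -- gadget only on the segment of `v`.
  have hfor : ∀ u ∈ S, ∀ i < k, ∀ d p q, (d, p, q) ∈ (f u).edges → (d, p, q) ∈ (g i).edges →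
      d = true ∧ q = 0 ∧ 0 ≤ p ∧ p < N - 1 ∧ u = v := by
    intro u hu i hi d p q h1 h2
    cases d
    · have h3 := hg.column i hi p q h2
      have := Int.le_of_dvd (by omega) (hcol u p q h1)
      omega
    · rcases hg.row i hi p q h2 with rfl | ⟨rfl, h4, h5⟩
      · have := Int.le_of_dvd (by omega) (hrow u p 1 h1)
        omega
      · refine ⟨rfl, rfl, h4, h5, ?_⟩
        by_contra huv
        exact (hseg p h4 (by omega)).2 u hu huv h1
  have hbase : ∀ i < k, ∀ p, (true, p, 0) ∈ (g i).edges → (true, p, 0) ∈ (f v).edges := by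
    intro i hi p h
    have := hg.row i hi p 0 h
    exact (hseg p (by omega) (by omega)).1
  have hadj1 : ∀ u ∈ S, ∀ i < k,
      (G.Adj u (w i) ↔ ∃ e, e ∈ (f u).edges ∧ e ∈ (g i).edges) := by
    intro u hu i hi
    rw [hw.adj_base u hu i hi, ← hg.base i hi]
    constructor
    · rintro ⟨rfl, p, hp⟩
      exact ⟨_, hbase i hi p hp, hp⟩
    · rintro ⟨⟨d, p, q⟩, h1, h2⟩
      obtain ⟨rfl, rfl, -, -, rfl⟩ := hfor u hu i hi d p q h1 h2
      exact ⟨rfl, p, h2⟩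
  have hadj2 : ∀ i < k, ∀ j < k, i ≠ j →
      (G.Adj (w i) (w j) ↔ ∃ e, e ∈ (g i).edges ∧ e ∈ (g j).edges) := by
    intro i hi j hj hij
    rw [hw.adj i hi j hj, ← hg.adj i hi j hj hij]
    simp only [Prod.exists]
  have hadj : ∀ x ∈ S ∪ w '' {i | i < k}, ∀ y ∈ S ∪ w '' {i | i < k}, x ≠ y →
      (G.Adj x y ↔ ∃ e, e ∈ (F x).edges ∧ e ∈ (F y).edges) := by
    rintro x (hx | ⟨i, hi, rfl⟩) y (hy | ⟨j, hj, rfl⟩) hxy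
    · rw [hFS x hx, hFS y hy]
      exact hf.adj x hx y hy hxy
    · rw [hFS x hx, hFw j hj]
      exact hadj1 x hx j hj
    · rw [hFS y hy, hFw i hi, G.adj_comm, hadj1 y hy i hi]
      simp only [and_comm]
    · rw [hFw i hi, hFw j hj]
      exact hadj2 i hi j hj fun h => hxy (h ▸ rfl)
  have hown : ∀ x ∈ S ∪ w '' {i | i < k}, ∃ e ∈ (F x).edges,
      ∀ y ∈ S ∪ w '' {i | i < k}, y ≠ x → e ∉ (F y).edges := by
    rintro x (hx | ⟨i, hi, rfl⟩)
    · rw [hFS x hx]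
      by_cases hxv : x = v
      · subst hxv
        -- The gadget leaves the last edge of the segment free.
        refine ⟨(true, N - 1, 0), (hseg _ (by omega) (by omega)).1, ?_⟩
        rintro y (hy | ⟨j, hj, rfl⟩) hyx
        · rw [hFS y hy]
          exact (hseg _ (by omega) (by omega)).2 y hy hyx
        · rw [hFw j hj]
          intro h
          have := hg.row j hj _ _ h
          omega
      · obtain ⟨e, he, he'⟩ := hf.exists_own x hx
        refine ⟨e, he, ?_⟩
        rintro y (hy | ⟨j, hj, rfl⟩) hyx
        · rw [hFS y hy]
          exact he' y hy hyx
        · rw [hFw j hj]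
          exact fun h => hxv (hfor x hx j hj _ _ _ he h).2.2.2.2
    · rw [hFw i hi]
      obtain ⟨d, p, q, h1, h2, h3⟩ := hg.own i hi
      refine ⟨(d, p, q), h1, ?_⟩
      rintro y (hy | ⟨j, hj, rfl⟩) hyx
      · rw [hFS y hy]
        intro h
        have := hfor y hy i hi _ _ _ h h1
        exact h2 this.1 this.2.1
      · rw [hFw j hj]
        exact h3 j hj fun h => hyx (h ▸ rfl)
  refine ⟨F, hadj, hown, fun T hT hne hcl => ?_⟩
  by_cases hTS : T ⊆ S
  · obtain ⟨e, he⟩ := hf.clique T hTS hne hcl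
    exact ⟨e, fun u hu => by rw [hFS u (hTS hu)]; exact he u hu⟩
  obtain ⟨x, hxT, hxS⟩ := Set.not_subset.1 hTS
  obtain ⟨i, hi, rfl⟩ : ∃ i, i < k ∧ w i = x := (hT hxT).resolve_left hxS
  have hTv : ∀ u ∈ T, u ∈ S → u = v ∧ (i = 0 ∨ i + 1 = k) := fun u hu huS =>
    (hw.adj_base u huS i hi).1 (hcl hu hxT fun h => hxS (h ▸ huS))
  -- Here the clique lies in the triangle `v`, `w 0`, `w 1`.
  by_cases hk : k = 2
  · obtain ⟨p, hp⟩ := hg.common hk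
    refine ⟨(true, p, 0), fun u hu => ?_⟩
    rcases hT hu with huS | ⟨j, hj, rfl⟩
    · rw [hFS u huS, (hTv u hu huS).1]
      exact hbase i hi p (hp i hi)
    · rw [hFw j hj]
      exact hp j hj
  -- For `k ≠ 2` no triangle contains `w i`, so the clique has at most one further vertex.
  by_cases hT1 : ∃ t ∈ T, t ≠ w i
  · obtain ⟨t, ht, hti⟩ := hT1
    obtain ⟨e, he1, he2⟩ := (hadj t (hT ht) (w i) (hT hxT) hti).1 (hcl ht hxT hti)
    refine ⟨e, fun u hu => ?_⟩
    by_cases hui : u = w i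
    · rwa [hui]
    suffices u = t by rwa [this]
    by_contra hut
    have hA := hcl hu ht hut
    have hB := hcl hu hxT hui
    have hC := hcl ht hxT hti
    rcases hT hu with huS | ⟨j, hj, rfl⟩ <;> rcases hT ht with htS | ⟨l, hl, rfl⟩
    · exact hut ((hTv u hu huS).1.trans (hTv t ht htS).1.symm)
    · have h1 := hTv u hu huS
      have h2 := (hw.adj_base u huS l hl).1 hA
      have h3 := (hw.adj l hl i hi).1 hC
      omega
    · have h1 := hTv t ht htS
      have h2 := (hw.adj_base t htS j hj).1 hA.symm
      have h3 := (hw.adj j hj i hi).1 hB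
      omega
    · have h1 := (hw.adj j hj l hl).1 hA
      have h2 := (hw.adj j hj i hi).1 hB
      have h3 := (hw.adj l hl i hi).1 hC
      omega
  · obtain ⟨e, he, -⟩ := hown (w i) (hT hxT)
    refine ⟨e, fun u hu => ?_⟩
    obtain rfl : u = w i := by
      by_contra h
      exact hT1 ⟨u, hu, h⟩
    exact he

theorem exists_model_singleton (r : V) :
    ∃ f : V → Corner, IsHellyModel G {r} fun u => (f u).edges := by
  have h : (true, 0, 0) ∈ (Corner.mk 1 0 0 0).edges := by
    rw [Corner.true_mem_edges]
    dsimp only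
    omega
  refine ⟨fun _ => ⟨1, 0, 0, 0⟩, ?_, ?_, ?_⟩
  · rintro u rfl v rfl huv
    exact (huv rfl).elim
  · rintro u rfl
    refine ⟨_, h, ?_⟩
    rintro v rfl hv
    exact (hv rfl).elim
  · exact fun _ _ _ _ => ⟨_, fun _ _ => h⟩

theorem IsHellyModel.isHellyBEPG {f : V → Corner}
    (hf : IsHellyModel G Set.univ fun u => (f u).edges) : IsHellyBEPG 1 G := by
  choose p hp hbend hedge using fun u => (f u).exists_walk
  have hshare : ∀ u v, (∃ e, e ∈ (p u).edges ∧ e ∈ (p v).edges) ↔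
      ∃ e, e ∈ (f u).edges ∧ e ∈ (f v).edges := by
    intro u v
    constructor
    · rintro ⟨e, h1, h2⟩
      obtain ⟨d, i, j, h3, rfl⟩ := (hedge u e).1 h1
      obtain ⟨d', i', j', h4, h⟩ := (hedge v _).1 h2
      obtain ⟨rfl, rfl, rfl⟩ := gridEdge_inj.1 h
      exact ⟨(d', i', j'), h3, h4⟩
    · rintro ⟨⟨d, i, j⟩, h1, h2⟩
      exact ⟨gridEdge d i j, (hedge u _).2 ⟨d, i, j, h1, rfl⟩, (hedge v _).2 ⟨d, i, j, h2, rfl⟩⟩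
  refine ⟨⟨_, _, p, hp, fun u => ?_, fun u v huv => ?_⟩, hbend, fun T hT hpair => ?_⟩
  -- A corner may degenerate to a point; the private edge excludes this.
  · obtain ⟨⟨d, i, j⟩, he, -⟩ := hf.exists_own u trivial
    have := (hedge u _).2 ⟨d, i, j, he, rfl⟩
    rw [← Walk.length_edges]
    exact List.length_pos_of_mem this
  · rw [hshare, hf.adj u trivial v trivial huv]
  · obtain ⟨⟨d, i, j⟩, he⟩ := hf.clique T (Set.subset_univ T) hT fun u hu v hv huv =>
      (hf.adj u trivial v trivial huv).2 ((hshare u v).1 (hpair hu hv huv))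
    exact ⟨gridEdge d i j, fun u hu => (hedge u _).2 ⟨d, i, j, he u hu, rfl⟩⟩

end CornerModel

theorem mainTheorem8 {V : Type*} [Finite V] (G : SimpleGraph V) (hG : IsCactus G) :
    IsHellyBEPG 1 G := by
  obtain ⟨f, hf⟩ := hG.set_induction
    (P := fun S => ∃ f : V → Corner, IsHellyModel G S fun u => (f u).edges)
    exists_model_singleton fun _ _ _ _ hw hS => hw.exists_model hS
  exact hf.isHellyBEPG
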